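/- Let $m>1$ be an integer, let $f$ be a polynomial with integer coefficients and $\deg f>1$, and let $s\ge 1$ be an integer. For an integer $a$ let $a \bmod m^n\in\{0,\dots,m^n-1\}$ denote its least nonnegative residue modulo $m^n$, and let $f^{(i)}$ denote the $i$-th iterate of $f$ ($f^{(0)}(x)=x$, $f^{(i+1)}(x)=f(f^{(i)}(x))$). For each $n$ let $\kappa_n$ be a random variable (on any probability space, which may depend on $n$) uniformly distributed on $\{0,1,\dots,m^n-1\}$. Then, as $n\to\infty$, the random vectors $$\eta_n=\left(\frac{\kappa_n}{m^n},\ \frac{f(\kappa_n)\bmod m^n}{m^n},\ \dots,\ \frac{f^{(s-1)}(\kappa_n)\bmod m^n}{m^n}\right)$$ converge weakly to the continuous uniform distribution on $[0,1)^s$. In terms of cumulative distribution functions, for every $(z_1,\dots,z_s)\in\mathbb R^s$, $$\lim_{n\to\infty}\mathbb P\bigl(\eta_n(1)\le z_1,\dots,\eta_n(s)\le z_s\bigr)=\prod_{i=1}^s U(z_i),\qquad U(z)=\begin{cases}0,& z<0,\\ z,& 0\le z\le 1,\\ 1,& z>1.\end{cases}$$ -/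

import Mathlib

open MeasureTheory ProbabilityTheory Filter Topology

/-- For an integer polynomial `f` and an integer `x`, the vector
`((x mod m^n)/m^n, (f(x) mod m^n)/m^n, …, (f^{(s-1)}(x) mod m^n)/m^n)`, where `f^{(i)}` is the
`i`-th iterate of the function `x ↦ f(x)` on `ℤ` (with `f^{(0)}(x) = x`) and `a mod m^n` is the
least nonnegative residue. For `x ∈ {0, …, m^n - 1}` the first coordinate is `x / m^n`. -/
noncomputable def iterateVector (m : ℕ) (f : Polynomial ℤ) (s n : ℕ) (x : ℤ) : Fin s → ℝ :=
  fun i => ((((fun y : ℤ => f.eval y)^[(i : ℕ)] x) % (m : ℤ) ^ n : ℤ) : ℝ) / (m : ℝ) ^ n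

/-- The cumulative distribution function of the uniform distribution on the unit interval. -/
noncomputable def uniformCDF (x : ℝ) : ℝ :=
  if x < 0 then 0 else if x ≤ 1 then x else 1

/-!
The proof is Weyl's equidistribution criterion on the torus `(ℝ/ℤ)^s`. For a nonzero frequency `k`,
the corresponding Fourier coefficient of the law of the vector is the complete exponential sum
`m⁻ⁿ ∑_{a < mⁿ} e(g(a) / mⁿ)` with `g = ∑ᵢ kᵢ f^{(i)}`. Since `deg f > 1`, the iterates of `f` have
pairwise different positive degrees, so `g` is not constant
(`natDegree_sum_iterate_comp_pos`), and everything rests on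
`tendsto_average_stdAddChar_eval`: such averages tend to `0` for every nonconstant `g ∈ ℤ[X]`.

To see this, average the summand over the shifts `a ↦ a + m^l v`, where `l = ⌈n/2⌉`. As
`m^(2l) ≡ 0` modulo `mⁿ`, Taylor expansion gives `g(a + m^l v) ≡ g(a) + g'(a) m^l v`, and the sum
over `v` vanishes unless `m^(n-l) ∣ g'(a)` (`norm_sum_stdAddChar_eval_le`). Take a prime `p ∣ m`.
By compactness of `ℤ_p`, an integer `a` with `g'(a)` divisible by a high power of `p` is `p`-adically
close to one of the at most `deg g'` roots of `g'` in `ℤ_p`, so it lies in one of at most `deg g'`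
classes modulo `p^j` (`exists_residues_of_pow_dvd_eval`); the density of such `a` is at most
`deg g' / p^j`, for any prescribed `j`.

Convergence on the torus is transferred to the cube by the portmanteau theorem
(`tendsto_of_tendsto_map_toUnitAddTorus`): the projection is open, it is injective on `[0,1)^s`, and
the limit law does not charge the boundary. The distribution functions converge because lower
orthants, being convex, have Lebesgue-null boundary.
-/

/-! ### Residues at which a polynomial is divisible by a high prime power -/

/-- Integers at which `G` is divisible by a large power of `p` fill at most `deg G` residue classes
modulo `p ^ j`: the classes of the `p`-adic integer roots of `G`. -/
theorem exists_residues_of_pow_dvd_eval (p : ℕ) [Fact p.Prime] {G : Polynomial ℤ} (hG : G ≠ 0)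
    (j : ℕ) :
    ∃ T : Finset (ZMod (p ^ j)), T.card ≤ G.natDegree ∧
      ∃ K : ℕ, ∀ a : ℤ, (p : ℤ) ^ K ∣ G.eval a → (a : ZMod (p ^ j)) ∈ T := by
  classical
  set Gp : Polynomial ℤ_[p] := G.map (Int.castRingHom ℤ_[p]) with hGp
  have hGp0 : Gp ≠ 0 := (Polynomial.map_ne_zero_iff (RingHom.injective_int _)).2 hG
  set T : Finset (ZMod (p ^ j)) := Gp.roots.toFinset.image (PadicInt.toZModPow j) with hT
  refine ⟨T, ?_, ?_⟩
  · calc T.card ≤ Gp.roots.toFinset.card := Finset.card_image_le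
      _ ≤ Gp.roots.card := Gp.roots.toFinset_card_le
      _ ≤ Gp.natDegree := Gp.card_roots'
      _ ≤ G.natDegree := Polynomial.natDegree_map_le
  set V : ℕ → Set ℤ_[p] := fun k => {x | ‖Gp.eval x‖ ≤ (p : ℝ) ^ (-k : ℤ)} with hV
  have hp1 : (1 : ℝ) < p := by exact_mod_cast (Fact.out : p.Prime).one_lt
  have hanti : Antitone V := fun k l hkl x hx =>
    le_trans hx (zpow_le_zpow_right₀ hp1.le (by omega))
  have hclosed (k : ℕ) : IsClosed (V k) :=
    isClosed_le (Gp.continuous.norm) continuous_const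
  -- The decreasing compact sets `V k` intersect in the zero set of `G`, so some `V K` lies in the
  -- open set of points congruent to a zero modulo `p ^ j`.
  obtain ⟨K, hK⟩ := exists_subset_nhds_of_isCompact (V := V) (U := {x | PadicInt.toZModPow j x ∈ T})
    hanti.directed_ge (fun k => (hclosed k).isCompact) (by
      intro x hx
      have hx0 : Gp.eval x = 0 := by
        rw [← norm_le_zero_iff]
        have hlim : Tendsto (fun k : ℕ => (p : ℝ) ^ (-k : ℤ)) atTop (𝓝 0) := by
          simp only [zpow_neg, zpow_natCast]
          exact (tendsto_pow_atTop_atTop_of_one_lt hp1).inv_tendsto_atTop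
        exact ge_of_tendsto' hlim fun k => Set.mem_iInter.1 hx k
      have hpos : (0 : ℝ) < (p : ℝ) ^ (-j : ℤ) := zpow_pos (by linarith) _
      filter_upwards [Metric.closedBall_mem_nhds x hpos] with y hy
      have hmem : y - x ∈ RingHom.ker (PadicInt.toZModPow (p := p) j) := by
        rw [PadicInt.ker_toZModPow, ← PadicInt.norm_le_pow_iff_mem_span_pow]
        simpa [dist_eq_norm] using hy
      have hyx : PadicInt.toZModPow j y = PadicInt.toZModPow j x := by
        rwa [RingHom.mem_ker, map_sub, sub_eq_zero] at hmem
      change PadicInt.toZModPow j y ∈ T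
      rw [hyx]
      exact Finset.mem_image_of_mem _
        (Multiset.mem_toFinset.2 ((Polynomial.mem_roots hGp0).2 hx0)))
  refine ⟨K, fun a ha => ?_⟩
  have haV : (a : ℤ_[p]) ∈ V K := by
    have heval : Gp.eval (a : ℤ_[p]) = ((G.eval a : ℤ) : ℤ_[p]) := by
      exact Polynomial.eval_map_apply (p := G) (f := Int.castRingHom ℤ_[p]) a
    change ‖Gp.eval (a : ℤ_[p])‖ ≤ _
    rw [heval, PadicInt.norm_int_le_pow_iff_dvd]
    exact_mod_cast ha
  simpa using hK haV

/-- Over complete periods modulo `p ^ j`, the integers at which `G` is divisible by a large power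
of `p` have proportion at most `deg G / p ^ j`. -/
theorem card_filter_pow_dvd_eval_le (p : ℕ) [Fact p.Prime] {G : Polynomial ℤ} (hG : G ≠ 0)
    (j : ℕ) :
    ∃ K : ℕ, ∀ N : ℕ, p ^ j ∣ N →
      ((Finset.range N).filter fun a : ℕ => (p : ℤ) ^ K ∣ G.eval (a : ℤ)).card * p ^ j
        ≤ G.natDegree * N := by
  classical
  obtain ⟨T, hT, K, hK⟩ := exists_residues_of_pow_dvd_eval p hG j
  refine ⟨K, fun N hN => ?_⟩
  obtain ⟨M, rfl⟩ := hN
  have hpj : 0 < p ^ j := pow_pos (Fact.out : p.Prime).pos j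
  have : NeZero (p ^ j) := ⟨hpj.ne'⟩
  set S := (Finset.range (p ^ j * M)).filter fun a : ℕ => (p : ℤ) ^ K ∣ G.eval (a : ℤ)
  have hfib (t : ZMod (p ^ j)) :
      ((Finset.range (p ^ j * M)).filter fun a : ℕ => (a : ZMod (p ^ j)) = t).card = M := by
    have h := Nat.count_modEq_card (p ^ j * M) hpj t.val
    rw [Nat.count_eq_card_filter_range] at h
    simp only [Nat.mul_mod_right, Nat.mul_div_cancel_left _ hpj, Nat.not_lt_zero, if_false,
      add_zero] at h
    refine Eq.trans ?_ h
    exact congrArg Finset.card (Finset.filter_congr fun a _ => by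
      simp [← ZMod.natCast_eq_natCast_iff])
  have hS : S.card ≤ M * T.card :=
    Finset.card_le_mul_card_image_of_maps_to (f := fun a : ℕ => (a : ZMod (p ^ j)))
      (fun a ha => by simpa using hK a (Finset.mem_filter.1 ha).2) M fun t _ => by
        rw [← hfib t]
        exact Finset.card_le_card (Finset.filter_subset_filter _ (Finset.filter_subset _ _))
  calc S.card * p ^ j ≤ (M * T.card) * p ^ j := Nat.mul_le_mul_right _ hS
    _ ≤ (M * G.natDegree) * p ^ j := by gcongr
    _ = G.natDegree * (p ^ j * M) := by ring

/-! ### Complete exponential sums modulo `m ^ n` -/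

/-- An exponential sum of `g` modulo `m ^ n` is bounded by the number of near-stationary points,
those `a` with `m ^ k ∣ g'(a)`, where `k ≤ n / 2`. -/
theorem norm_sum_stdAddChar_eval_le {m n k l : ℕ} [NeZero (m ^ n)] (hkl : k + l = n) (hk : k ≤ l)
    (hm : m ≠ 0) (g : Polynomial ℤ) :
    ‖∑ a ∈ Finset.range (m ^ n), ZMod.stdAddChar ((g.eval (a : ℤ) : ℤ) : ZMod (m ^ n))‖ ≤
      ((Finset.range (m ^ n)).filter fun a : ℕ =>
        (m : ℤ) ^ k ∣ (Polynomial.derivative g).eval (a : ℤ)).card := by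
  classical
  set ψ : AddChar (ZMod (m ^ n)) ℂ := ZMod.stdAddChar
  set gq : Polynomial (ZMod (m ^ n)) := g.map (Int.castRingHom _) with hgq
  have heval (h : Polynomial ℤ) (a : ℤ) :
      ((h.eval a : ℤ) : ZMod (m ^ n)) = (h.map (Int.castRingHom _)).eval (a : ZMod (m ^ n)) := by
    exact (Polynomial.eval_map_apply (p := h) (f := Int.castRingHom (ZMod (m ^ n))) a).symm
  have htoZMod {M : Type} [AddCommMonoid M] (F : ZMod (m ^ n) → M) :
      ∑ a ∈ Finset.range (m ^ n), F a = ∑ x, F x := by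
    refine Finset.sum_bij' (fun a _ => (a : ZMod (m ^ n))) (fun x _ => x.val) ?_ ?_ ?_ ?_ ?_
    · simp
    · intro x _; exact Finset.mem_range.2 x.val_lt
    · intro a ha; exact ZMod.val_cast_of_lt (Finset.mem_range.1 ha)
    · intro x _; exact ZMod.natCast_zmod_val x
    · simp
  set S : ℂ := ∑ x, ψ (gq.eval x)
  have hS : ∑ a ∈ Finset.range (m ^ n), ψ ((g.eval (a : ℤ) : ℤ) : ZMod (m ^ n)) = S := by
    refine Eq.trans (Finset.sum_congr rfl fun a _ => ?_) (htoZMod fun x => ψ (gq.eval x))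
    rw [heval, Int.cast_natCast]
  rw [hS]
  set b : ZMod (m ^ n) := (m : ZMod (m ^ n)) ^ l
  have hb2 : b ^ 2 = 0 := by
    have : (m : ZMod (m ^ n)) ^ n = 0 := by exact_mod_cast ZMod.natCast_self (m ^ n)
    rw [← pow_mul, show l * 2 = n + (l - k) by omega, pow_add, this, zero_mul]
  set d : ZMod (m ^ n) → ZMod (m ^ n) := fun x => gq.derivative.eval x * b
  -- Taylor expansion at `x`; the quadratic term vanishes because `b ^ 2 = 0`.
  have hshift (x : ZMod (m ^ n)) (v : ℕ) :
      ψ (gq.eval (x + v * b)) = ψ (gq.eval x) * ψ (d x) ^ v := by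
    obtain ⟨c, hc⟩ := gq.binomExpansion x (v * b)
    rw [hc, mul_pow, hb2, mul_zero, mul_zero, add_zero, AddChar.map_add_eq_mul,
      ← AddChar.map_nsmul_eq_pow]
    congr 2
    simp only [d, nsmul_eq_mul]; ring
  -- Hence the sum over `v` is geometric with ratio a root of unity of order dividing `m ^ k`.
  have hroot (x : ZMod (m ^ n)) : ψ (d x) ^ (m ^ k) = 1 := by
    rw [← AddChar.map_nsmul_eq_pow, nsmul_eq_mul]
    have : ((m ^ k : ℕ) : ZMod (m ^ n)) * d x = 0 := by
      have : (m : ZMod (m ^ n)) ^ n = 0 := by exact_mod_cast ZMod.natCast_self (m ^ n)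
      simp only [d, b, Nat.cast_pow]
      rw [mul_left_comm, ← pow_add, hkl, this, mul_zero]
    rw [this, AddChar.map_zero_eq_one]
  have hinner (x : ZMod (m ^ n)) :
      ‖∑ v ∈ Finset.range (m ^ k), ψ (gq.eval (x + v * b))‖ ≤
        if d x = 0 then (m : ℝ) ^ k else 0 := by
    simp_rw [hshift, ← Finset.mul_sum, norm_mul]
    split_ifs with hd
    · simp [hd]
    · have hne : ψ (d x) ≠ 1 := fun h => hd
        (ZMod.injective_stdAddChar (h.trans (AddChar.map_zero_eq_one _).symm))
      rw [geom_sum_eq hne, hroot]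
      simp
  -- Translation by `v * b` permutes `ZMod (m ^ n)`, so every shifted sum equals `S`.
  have havg : (m : ℂ) ^ k * S =
      ∑ x, ∑ v ∈ Finset.range (m ^ k), ψ (gq.eval (x + v * b)) := by
    rw [Finset.sum_comm]
    have (v : ℕ) : ∑ x, ψ (gq.eval (x + v * b)) = S :=
      Fintype.sum_equiv (Equiv.addRight ((v : ZMod (m ^ n)) * b)) _ _ fun _ => rfl
    simp [this]
  have hmk : (0 : ℝ) < (m : ℝ) ^ k := pow_pos (by exact_mod_cast Nat.pos_of_ne_zero hm) _
  have hdvd (a : ℕ) : d a = 0 ↔ (m : ℤ) ^ k ∣ (Polynomial.derivative g).eval (a : ℤ) := by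
    have h1 : d a = (((Polynomial.derivative g).eval (a : ℤ) * (m : ℤ) ^ l : ℤ) : ZMod (m ^ n)) := by
      rw [Int.cast_mul, heval, ← Polynomial.derivative_map]
      simp [d, b, hgq]
    rw [h1, ZMod.intCast_zmod_eq_zero_iff_dvd, ← hkl, pow_add]
    push_cast
    exact mul_dvd_mul_iff_right (pow_ne_zero _ (by exact_mod_cast hm))
  refine le_of_mul_le_mul_left ?_ hmk
  calc (m : ℝ) ^ k * ‖S‖ = ‖(m : ℂ) ^ k * S‖ := by simp
    _ ≤ ∑ x, if d x = 0 then (m : ℝ) ^ k else 0 := by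
      rw [havg]
      exact (norm_sum_le _ _).trans (Finset.sum_le_sum fun x _ => hinner x)
    _ = ∑ a ∈ Finset.range (m ^ n), if d a = 0 then (m : ℝ) ^ k else 0 :=
      (htoZMod fun x => if d x = 0 then (m : ℝ) ^ k else 0).symm
    _ = _ := by
      rw [← Finset.sum_filter, Finset.sum_const, nsmul_eq_mul, mul_comm]
      simp_rw [hdvd]

/-- The normalized exponential sums of a nonconstant integer polynomial modulo `m ^ n` tend
to `0`. -/
theorem tendsto_average_stdAddChar_eval {m : ℕ} (hm : 1 < m) [∀ n, NeZero (m ^ n)]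
    {g : Polynomial ℤ} (hg : 0 < g.natDegree) :
    Tendsto (fun n => ((m : ℂ) ^ n)⁻¹ *
      ∑ a ∈ Finset.range (m ^ n), ZMod.stdAddChar ((g.eval (a : ℤ) : ℤ) : ZMod (m ^ n)))
      atTop (𝓝 0) := by
  classical
  obtain ⟨p, hp, hpm⟩ := Nat.exists_prime_and_dvd hm.ne'
  have : Fact p.Prime := ⟨hp⟩
  set G := Polynomial.derivative g
  have hG : G ≠ 0 := fun h => hg.ne' (Polynomial.derivative_eq_zero.1 h)
  rw [Metric.tendsto_atTop]
  intro ε hε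
  have hp1 : (1 : ℝ) < p := by exact_mod_cast hp.one_lt
  obtain ⟨j, hj⟩ := pow_unbounded_of_one_lt (G.natDegree / ε) hp1
  obtain ⟨K, hK⟩ := card_filter_pow_dvd_eval_le p hG j
  -- `n ≥ 2 * K` gives `p ^ K ∣ m ^ (n / 2)`, and `n ≥ j` makes `m ^ n` a multiple of `p ^ j`.
  refine ⟨2 * K + j, fun n hn => ?_⟩
  have hbound := norm_sum_stdAddChar_eval_le (m := m) (n := n) (k := n / 2) (l := n - n / 2)
    (by omega) (by omega) (by omega) g
  have hsub : ((Finset.range (m ^ n)).filter fun a : ℕ => (m : ℤ) ^ (n / 2) ∣ G.eval (a : ℤ)).card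
      ≤ ((Finset.range (m ^ n)).filter fun a : ℕ => (p : ℤ) ^ K ∣ G.eval (a : ℤ)).card := by
    refine Finset.card_le_card (Finset.monotone_filter_right _ fun a _ ha => ?_)
    refine ((pow_dvd_pow (p : ℤ) (show K ≤ n / 2 by omega)).trans ?_).trans ha
    exact pow_dvd_pow_of_dvd (by exact_mod_cast hpm) _
  have hcard := hK (m ^ n) ((pow_dvd_pow p (show j ≤ n by omega)).trans (pow_dvd_pow_of_dvd hpm n))
  set C := ((Finset.range (m ^ n)).filter fun a : ℕ => (p : ℤ) ^ K ∣ G.eval (a : ℤ)).card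
  have hcard' : (C : ℝ) * (p : ℝ) ^ j ≤ G.natDegree * (m : ℝ) ^ n := by exact_mod_cast hcard
  have hmn : (0 : ℝ) < (m : ℝ) ^ n := pow_pos (by exact_mod_cast (zero_lt_one.trans hm)) _
  have hpj : (0 : ℝ) < (p : ℝ) ^ j := pow_pos (by linarith) _
  have hC : (C : ℝ) < ε * (m : ℝ) ^ n := by
    refine lt_of_mul_lt_mul_right ?_ hpj.le
    refine hcard'.trans_lt ?_
    rw [div_lt_iff₀ hε] at hj
    nlinarith
  rw [dist_zero_right, norm_mul, norm_inv, norm_pow, Complex.norm_natCast,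
    inv_mul_lt_iff₀ hmn, mul_comm]
  exact (hbound.trans (by exact_mod_cast hsub)).trans_lt hC

/-- A nontrivial combination of the iterates of `f` is not constant: the `i`-th iterate has degree
`(deg f) ^ i`, so leading terms cannot cancel. -/
theorem natDegree_sum_iterate_comp_pos {f : Polynomial ℤ} (hf : 1 < f.natDegree) {s : ℕ}
    {h : Fin s → ℤ} (hh : h ≠ 0) :
    0 < (∑ i : Fin s, Polynomial.C (h i) * f.comp^[(i : ℕ)] Polynomial.X).natDegree := by
  have hdeg (i : Fin s) : (f.comp^[(i : ℕ)] Polynomial.X).natDegree = f.natDegree ^ (i : ℕ) := by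
    simp [Polynomial.natDegree_iterate_comp]
  have hdegC (i : Fin s) (hi : h i ≠ 0) :
      (Polynomial.C (h i) * f.comp^[(i : ℕ)] Polynomial.X).natDegree = f.natDegree ^ (i : ℕ) := by
    rw [Polynomial.natDegree_C_mul hi, hdeg]
  obtain ⟨i, hi⟩ := Function.ne_iff.1 hh
  rw [Polynomial.natDegree_sum_eq_of_disjoint]
  · have h1 : f.natDegree ^ (i : ℕ) ≤ _ :=
      (hdegC i hi).symm.le.trans (Finset.le_sup (f := fun i : Fin s =>
        (Polynomial.C (h i) * f.comp^[(i : ℕ)] Polynomial.X).natDegree) (Finset.mem_univ i))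
    exact (pow_pos (by omega) _).trans_le h1
  · rintro a ⟨-, ha⟩ b ⟨-, hb⟩ hab
    have ha' : h a ≠ 0 := fun h0 => ha (by simp [h0])
    have hb' : h b ≠ 0 := fun h0 => hb (by simp [h0])
    simp only [Function.onFun, Function.comp, hdegC _ ha', hdegC _ hb']
    exact fun he => hab (Fin.ext (Nat.pow_right_injective hf he))

/-! ### Weak convergence on the torus and on the cube -/

/-- Convergence of all Fourier coefficients implies weak convergence on the torus. -/
theorem UnitAddTorus.tendsto_of_tendsto_integral_mFourier {d : Type*} [Fintype d]
    {μ : ℕ → ProbabilityMeasure (UnitAddTorus d)} {ν : ProbabilityMeasure (UnitAddTorus d)}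
    (h : ∀ k : d → ℤ, Tendsto (fun n => ∫ t, UnitAddTorus.mFourier k t ∂(μ n : Measure _)) atTop
      (𝓝 (∫ t, UnitAddTorus.mFourier k t ∂(ν : Measure _)))) :
    Tendsto μ atTop (𝓝 ν) := by
  have hint (g : C(UnitAddTorus d, ℂ)) (ρ : ProbabilityMeasure (UnitAddTorus d)) :
      Integrable g (ρ : Measure (UnitAddTorus d)) :=
    (BoundedContinuousFunction.mkOfCompact g).integrable _
  have hspan (g : C(UnitAddTorus d, ℂ))
      (hg : g ∈ Submodule.span ℂ (Set.range (UnitAddTorus.mFourier (d := d)))) :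
      Tendsto (fun n => ∫ t, g t ∂(μ n : Measure _)) atTop (𝓝 (∫ t, g t ∂(ν : Measure _))) := by
    induction hg using Submodule.span_induction with
    | mem g hg => obtain ⟨k, rfl⟩ := hg; exact h k
    | zero => simp
    | add g₁ g₂ _ _ h₁ h₂ =>
      simp only [ContinuousMap.add_apply]
      rw [integral_add (hint _ _) (hint _ _)]
      refine (h₁.add h₂).congr fun n => ?_
      rw [integral_add (hint _ _) (hint _ _)]
    | smul c g _ hg =>
      simp only [ContinuousMap.smul_apply, integral_smul]
      exact hg.const_smul c
  refine ProbabilityMeasure.tendsto_of_tight_of_separatesPoints ℂ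
    IsTightMeasureSet.of_compactSpace
    (A := (UnitAddTorus.mFourierSubalgebra d).comap
      (BoundedContinuousFunction.toContinuousMapStarₐ ℂ)) ?_ ?_
  · intro x y hxy
    obtain ⟨_, ⟨g, hg, rfl⟩, hgxy⟩ := UnitAddTorus.mFourierSubalgebra_separatesPoints hxy
    exact ⟨g, ⟨g, ⟨BoundedContinuousFunction.mkOfCompact g, hg, rfl⟩, rfl⟩, hgxy⟩
  · intro g hg
    refine hspan (g : C(UnitAddTorus d, ℂ)) ?_
    rw [← UnitAddTorus.mFourierSubalgebra_coe]
    exact hg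

/-- The coordinatewise projection from `ℝ^d` to the torus `(ℝ/ℤ)^d`. -/
def toUnitAddTorus {d : Type*} (x : d → ℝ) : UnitAddTorus d := fun i => (x i : UnitAddCircle)

theorem continuous_toUnitAddTorus {d : Type*} : Continuous (toUnitAddTorus (d := d)) :=
  continuous_pi fun i => (AddCircle.continuous_mk' 1).comp (continuous_apply i)

theorem isOpenMap_toUnitAddTorus {d : Type*} [Finite d] : IsOpenMap (toUnitAddTorus (d := d)) :=
  IsOpenMap.piMap (f := fun _ (t : ℝ) => (t : UnitAddCircle))
    (fun _ => QuotientAddGroup.isOpenMap_coe) (by simp)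

theorem injOn_toUnitAddTorus {d : Type*} :
    Set.InjOn (toUnitAddTorus (d := d)) (Set.univ.pi fun _ => Set.Ico (0 : ℝ) 1) := by
  intro x hx y hy hxy
  ext i
  have hx' := hx i trivial
  have hy' := hy i trivial
  have := congrFun hxy i
  exact (AddCircle.coe_eq_coe_iff_of_mem_Ico (p := (1 : ℝ)) (a := 0)
    (by simpa using hx') (by simpa using hy')).1 this

/-- Weak convergence on the torus lifts to the cube `[0,1)^d` when the limit law is carried by the
open cube. -/
theorem tendsto_of_tendsto_map_toUnitAddTorus {d : Type*} [Fintype d]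
    {μ : ℕ → ProbabilityMeasure (d → ℝ)} {ν : ProbabilityMeasure (d → ℝ)}
    (hμ : ∀ n, ∀ᵐ x ∂(μ n : Measure (d → ℝ)), x ∈ Set.univ.pi fun _ => Set.Ico (0 : ℝ) 1)
    (hν : ∀ᵐ x ∂(ν : Measure (d → ℝ)), x ∈ Set.univ.pi fun _ => Set.Ioo (0 : ℝ) 1)
    (h : Tendsto (fun n => (μ n).map continuous_toUnitAddTorus.measurable.aemeasurable) atTop
      (𝓝 (ν.map continuous_toUnitAddTorus.measurable.aemeasurable))) :
    Tendsto μ atTop (𝓝 ν) := by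
  have hm : Measurable (toUnitAddTorus (d := d)) := continuous_toUnitAddTorus.measurable
  refine tendsto_of_forall_isOpen_le_liminf' fun G hG => ?_
  -- The part of `G` in the open cube carries the mass of `ν` on `G`, and its image is open.
  set Q : Set (d → ℝ) := Set.univ.pi fun _ => Set.Ioo (0 : ℝ) 1
  set U := toUnitAddTorus '' (G ∩ Q)
  have hU : IsOpen U :=
    isOpenMap_toUnitAddTorus _ (hG.inter (isOpen_set_pi Set.finite_univ fun _ _ => isOpen_Ioo))
  calc (ν : Measure (d → ℝ)) G ≤ (ν : Measure (d → ℝ)) (toUnitAddTorus ⁻¹' U) :=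
        measure_mono_ae (hν.mono fun x hx hxG => ⟨x, ⟨hxG, hx⟩, rfl⟩)
    _ = (ν.map hm.aemeasurable : Measure (UnitAddTorus d)) U :=
        (Measure.map_apply hm hU.measurableSet).symm
    _ ≤ atTop.liminf fun n => ((μ n).map hm.aemeasurable : Measure (UnitAddTorus d)) U :=
        ProbabilityMeasure.le_liminf_measure_open_of_tendsto h hU
    _ ≤ atTop.liminf fun n => (μ n : Measure (d → ℝ)) G := by
        refine liminf_le_liminf (Eventually.of_forall fun n => ?_)
        refine (Measure.map_apply hm hU.measurableSet).trans_le
          (measure_mono_ae ((hμ n).mono ?_))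
        rintro x hx ⟨y, ⟨hyG, hyQ⟩, hyx⟩
        rwa [← injOn_toUnitAddTorus (fun i hi => ⟨(hyQ i hi).1.le, (hyQ i hi).2⟩) hx hyx]

theorem cond_volume_pi_Ico {d : Type*} [Fintype d] :
    ProbabilityTheory.cond (volume : Measure (d → ℝ)) (Set.univ.pi fun _ => Set.Ico (0 : ℝ) 1) =
      Measure.pi fun _ => volume.restrict (Set.Ico (0 : ℝ) 1) := by
  have h1 : (volume : Measure (d → ℝ)) (Set.univ.pi fun _ => Set.Ico (0 : ℝ) 1) = 1 := by
    simp [volume_pi_pi]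
  rw [ProbabilityTheory.cond, h1, inv_one, one_smul, volume_pi, Measure.restrict_pi_pi]

theorem integral_mFourier_toUnitAddTorus {d : Type*} [Fintype d] {k : d → ℤ} (hk : k ≠ 0) :
    ∫ x, UnitAddTorus.mFourier k (toUnitAddTorus x)
      ∂(Measure.pi fun _ : d => volume.restrict (Set.Ico (0 : ℝ) 1)) = 0 := by
  obtain ⟨i, hi⟩ := Function.ne_iff.1 hk
  change ∫ x : d → ℝ, ∏ i, (fourier (k i) (x i : UnitAddCircle) : ℂ) ∂_ = 0
  rw [integral_fintype_prod_eq_prod fun i (t : ℝ) => (fourier (k i) (t : UnitAddCircle) : ℂ)]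
  refine Finset.prod_eq_zero (Finset.mem_univ i) ?_
  have hc : (2 * Real.pi * Complex.I * k i : ℂ) ≠ 0 := by
    simpa [Real.pi_ne_zero] using hi
  rw [integral_Ico_eq_integral_Ioc, ← intervalIntegral.integral_of_le zero_le_one]
  have (t : ℝ) : (fourier (k i) (t : UnitAddCircle) : ℂ) =
      Complex.exp (2 * Real.pi * Complex.I * k i * t) := by
    rw [fourier_coe_apply]; simp
  simp_rw [this]
  rw [integral_exp_mul_complex hc]
  have : Complex.exp (2 * Real.pi * Complex.I * k i) = 1 := by
    rw [mul_comm]; exact Complex.exp_int_mul_two_pi_mul_I _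
  simp [this]

/-- Weyl's criterion for laws on the cube `[0,1)^d` with uniform limit. -/
theorem tendsto_of_tendsto_integral_mFourier_zero {d : Type*} [Fintype d]
    {μ : ℕ → ProbabilityMeasure (d → ℝ)} {ν : ProbabilityMeasure (d → ℝ)}
    (hμ : ∀ n, ∀ᵐ x ∂(μ n : Measure (d → ℝ)), x ∈ Set.univ.pi fun _ => Set.Ico (0 : ℝ) 1)
    (hν : (ν : Measure (d → ℝ)) = Measure.pi fun _ => volume.restrict (Set.Ico (0 : ℝ) 1))
    (h : ∀ k : d → ℤ, k ≠ 0 → Tendsto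
      (fun n => ∫ x, UnitAddTorus.mFourier k (toUnitAddTorus x) ∂(μ n : Measure (d → ℝ)))
      atTop (𝓝 0)) :
    Tendsto μ atTop (𝓝 ν) := by
  have hmap (k : d → ℤ) (ρ : ProbabilityMeasure (d → ℝ)) :
      ∫ t, UnitAddTorus.mFourier k t
        ∂(ρ.map continuous_toUnitAddTorus.measurable.aemeasurable : Measure (UnitAddTorus d)) =
      ∫ x, UnitAddTorus.mFourier k (toUnitAddTorus x) ∂(ρ : Measure (d → ℝ)) :=
    integral_map continuous_toUnitAddTorus.measurable.aemeasurable
      (UnitAddTorus.mFourier k).continuous.aestronglyMeasurable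
  refine tendsto_of_tendsto_map_toUnitAddTorus hμ ?_
    (UnitAddTorus.tendsto_of_tendsto_integral_mFourier fun k => ?_)
  · simp_rw [hν, ← Measure.restrict_congr_set (Ioo_ae_eq_Ico (μ := volume) (a := (0 : ℝ))),
      ← Measure.restrict_pi_pi]
    exact ae_restrict_mem (MeasurableSet.univ_pi fun _ => measurableSet_Ioo)
  · simp_rw [hmap]
    by_cases hk : k = 0
    · simp [hk, UnitAddTorus.mFourier_zero]
    · rw [hν, integral_mFourier_toUnitAddTorus hk]
      exact h k hk

/-! ### The law of the vector of iterates -/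

theorem integral_uniformOn_Ico (N : ℕ) (F : ℤ → ℂ) :
    ∫ x, F x ∂(uniformOn (Set.Ico (0 : ℤ) N)) = (N : ℂ)⁻¹ * ∑ a ∈ Finset.range N, F a := by
  have hI : Set.Ico (0 : ℤ) N = ((Finset.range N).image (Nat.cast : ℕ → ℤ) : Finset ℤ) := by
    ext x
    simp only [Set.mem_Ico, Finset.coe_image, Set.mem_image, Finset.coe_range, Set.mem_Iio]
    constructor
    · rintro ⟨h0, h1⟩; exact ⟨x.toNat, by omega, by omega⟩
    · rintro ⟨a, ha, rfl⟩; omega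
  have hcard : ((Finset.range N).image (Nat.cast : ℕ → ℤ)).card = N := by
    rw [Finset.card_image_of_injective _ Nat.cast_injective, Finset.card_range]
  have hint : IntegrableOn F ((Finset.range N).image (Nat.cast : ℕ → ℤ) : Finset ℤ)
      Measure.count := by
    set A : Finset ℤ := (Finset.range N).image (Nat.cast : ℕ → ℤ)
    have hfin : IsFiniteMeasure (Measure.count.restrict (A : Set ℤ)) :=
      ⟨by simp⟩
    have h := IntegrableOn.finset (μ := Measure.count.restrict (A : Set ℤ)) (s := A) (f := F)
    rwa [IntegrableOn, Measure.restrict_restrict A.measurableSet, Set.inter_self] at h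
  rw [uniformOn, ProbabilityTheory.cond, integral_smul_measure, hI, Measure.count_apply_finset,
    hcard, setIntegral_finset _ hint,
    Finset.sum_image (by simp)]
  simp [Measure.real]

theorem mFourier_toUnitAddTorus_iterateVector (m : ℕ) (f : Polynomial ℤ) (s n : ℕ)
    [NeZero (m ^ n)] (k : Fin s → ℤ) (x : ℤ) :
    UnitAddTorus.mFourier k (toUnitAddTorus (iterateVector m f s n x)) =
      ZMod.stdAddChar (((∑ i : Fin s,
        Polynomial.C (k i) * f.comp^[(i : ℕ)] Polynomial.X).eval x : ℤ) : ZMod (m ^ n)) := by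
  have hmn : (m : ℂ) ^ n ≠ 0 := by exact_mod_cast NeZero.ne (m ^ n)
  rw [Polynomial.eval_finsetSum, Int.cast_sum]
  have hsum : ∀ c : Fin s → ZMod (m ^ n),
      ZMod.stdAddChar (∑ i, c i) = ∏ i, ZMod.stdAddChar (c i) := fun c =>
    map_prod (ZMod.stdAddChar (N := m ^ n)).toMonoidHom (fun i => Multiplicative.ofAdd (c i))
      Finset.univ
  rw [hsum]
  change ∏ i, (fourier (k i) (iterateVector m f s n x i : UnitAddCircle) : ℂ) = _
  refine Finset.prod_congr rfl fun i _ => ?_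
  rw [Polynomial.eval_mul, Polynomial.eval_C, Polynomial.iterate_comp_eval, Polynomial.eval_X]
  set y := (fun y : ℤ => f.eval y)^[(i : ℕ)] x with hy
  -- Reduction modulo `m ^ n` disappears in the character since `k i` is an integer.
  have hmod : ((k i * y : ℤ) : ZMod (m ^ n)) = ((k i * (y % (m : ℤ) ^ n) : ℤ) : ZMod (m ^ n)) := by
    rw [ZMod.intCast_eq_intCast_iff]
    push_cast
    exact (Int.ModEq.refl _).mul (Int.mod_modEq _ _).symm
  rw [hmod, ZMod.stdAddChar_coe]
  simp only [iterateVector, ← hy]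
  rw [fourier_coe_apply]
  congr 1
  push_cast
  field_simp

theorem pi_restrict_Ico_Iic {d : Type*} [Fintype d] (z : d → ℝ) :
    (Measure.pi fun _ : d => volume.restrict (Set.Ico (0 : ℝ) 1)).real (Set.Iic z) =
      ∏ i, uniformCDF (z i) := by
  have h1 (t : ℝ) : (volume.restrict (Set.Ico (0 : ℝ) 1)).real (Set.Iic t) = uniformCDF t := by
    rw [Measure.restrict_congr_set Ico_ae_eq_Icc, measureReal_restrict_apply measurableSet_Iic,
      uniformCDF, ← Set.Ici_inter_Iic, ← Set.inter_assoc, Set.inter_comm (Set.Iic t),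
      Set.inter_assoc, Set.Iic_inter_Iic, Set.Ici_inter_Iic, Real.volume_real_Icc, sub_zero]
    grind
  rw [← Set.pi_univ_Iic, measureReal_def, Measure.pi_pi, ENNReal.toReal_prod]
  exact Finset.prod_congr rfl fun i _ => h1 (z i)

/-- The random variables `κ n` are uniform on `{0, …, m^n - 1}` (each on a probability space of
its own) and `Z` is uniform on `[0,1)^s`. The conclusion is weak convergence of the vectors, both
as weak convergence of laws and as pointwise convergence of cumulative distribution functions
(the limiting one is continuous everywhere). -/
theorem theorem2
    (m : ℕ) (hm : 1 < m)
    (f : Polynomial ℤ) (hf : 1 < f.natDegree)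
    (s : ℕ) (hs : 1 ≤ s)
    {Ω : ℕ → Type*} [∀ n, MeasurableSpace (Ω n)]
    (P : (n : ℕ) → Measure (Ω n)) [∀ n, IsProbabilityMeasure (P n)]
    (κ : (n : ℕ) → Ω n → ℤ)
    (hκ : ∀ n, HasLaw (κ n) (uniformOn (Set.Ico (0 : ℤ) ((m : ℤ) ^ n))) (P n))
    {Ω' : Type*} [MeasurableSpace Ω']
    (P' : Measure Ω') [IsProbabilityMeasure P']
    (Z : Ω' → Fin s → ℝ)
    (hZ : pdf.IsUniform Z (Set.univ.pi fun _ : Fin s => Set.Ico (0 : ℝ) 1) P' volume) :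
    TendstoInDistribution (fun n ω => iterateVector m f s n (κ n ω)) atTop Z P P' ∧
      ∀ z : Fin s → ℝ,
        Tendsto (fun n => (P n).real {ω | ∀ i, iterateVector m f s n (κ n ω) i ≤ z i}) atTop
          (𝓝 (∏ i, uniformCDF (z i))) := by
  have hNZ (n : ℕ) : NeZero (m ^ n) := ⟨pow_ne_zero _ (by omega)⟩
  have hmeas (n : ℕ) : Measurable (iterateVector m f s n) := measurable_from_top
  have hX (n : ℕ) : AEMeasurable (fun ω => iterateVector m f s n (κ n ω)) (P n) :=
    (hmeas n).comp_aemeasurable (hκ n).aemeasurable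
  have hlaw : P'.map Z = Measure.pi fun _ => volume.restrict (Set.Ico (0 : ℝ) 1) :=
    Eq.trans hZ cond_volume_pi_Ico
  have hvol : volume (Set.univ.pi fun _ : Fin s => Set.Ico (0 : ℝ) 1) = 1 := by
    simp [volume_pi_pi]
  have hZm : AEMeasurable Z P' := hZ.aemeasurable (by simp [hvol]) (by simp [hvol])
  have hT : TendstoInDistribution (fun n ω => iterateVector m f s n (κ n ω)) atTop Z P P' := by
    refine ⟨hX, hZm, tendsto_of_tendsto_integral_mFourier_zero (fun n => ?_) hlaw fun k hk => ?_⟩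
    · refine (ae_map_iff (hX n) (MeasurableSet.univ_pi fun _ => measurableSet_Ico)).2
        (Eventually.of_forall fun ω i _ => ?_)
      have hpos : (0 : ℤ) < (m : ℤ) ^ n := pow_pos (by omega) _
      have hposR : (0 : ℝ) < (m : ℝ) ^ n := by exact_mod_cast hpos
      refine ⟨div_nonneg (by exact_mod_cast Int.emod_nonneg _ hpos.ne') hposR.le, ?_⟩
      rw [iterateVector, div_lt_one hposR]
      exact_mod_cast Int.emod_lt_of_pos _ hpos
    · refine (tendsto_average_stdAddChar_eval hm (natDegree_sum_iterate_comp_pos hf hk)).congr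
        fun n => ?_
      have hN := integral_uniformOn_Ico (m ^ n) fun x =>
        UnitAddTorus.mFourier k (toUnitAddTorus (iterateVector m f s n x))
      push_cast at hN
      refine Eq.trans ?_ (integral_map (hX n) (f := fun y => UnitAddTorus.mFourier k (toUnitAddTorus y)) ((UnitAddTorus.mFourier k).continuous.comp
        continuous_toUnitAddTorus).aestronglyMeasurable).symm
      rw [← integral_map (φ := κ n) (hκ n).aemeasurable
        (f := fun x => UnitAddTorus.mFourier k (toUnitAddTorus (iterateVector m f s n x)))
        (measurable_from_top).aestronglyMeasurable, (hκ n).map_eq, hN]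
      simp_rw [mFourier_toUnitAddTorus_iterateVector]
  refine ⟨hT, fun z => ?_⟩
  have hfr : P'.map Z (frontier (Set.Iic z)) = 0 :=
    hZ.absolutelyContinuous (Convex.addHaar_frontier _ (convex_Iic z))
  have : IsProbabilityMeasure (P'.map Z) := Measure.isProbabilityMeasure_map hZm
  have hlim := ProbabilityMeasure.tendsto_measure_of_null_frontier_of_tendsto' hT.tendsto hfr
  rw [← pi_restrict_Ico_Iic, ← hlaw]
  refine ((ENNReal.tendsto_toReal (measure_ne_top (P'.map Z) _)).comp hlim).congr fun n => ?_
  exact congrArg ENNReal.toReal (Measure.map_apply_of_aemeasurable (hX n) measurableSet_Iic)
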